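/- Let $\Phi\in\mathbb R^{M\times N}$ have independent standard normal entries and let $\xi\in\mathbb R^M$, independent of $\Phi$, have independent entries uniform on $[0,\delta]$, where $\delta>0$. Let $\mathcal Q_\delta(\lambda)=\delta(\lfloor\lambda/\delta\rfloor+\tfrac12)$ be the uniform midrise quantizer, applied componentwise to vectors. For a non-empty bounded set $\mathcal K\subset\mathbb R^N$, the worst-case error of consistent reconstruction is $$\mathcal E_\delta(\Phi,\xi,\mathcal K)=\sup\{\|x-x^*\|_2 : x,x^*\in\mathcal K,\ \mathcal Q_\delta(\Phi x^*+\xi)=\mathcal Q_\delta(\Phi x+\xi)\}.$$ Let $\mathbb B^N$ be the closed Euclidean unit ball of $\mathbb R^N$, let $\Sigma_K$ be the set of vectors of $\mathbb R^N$ with at most $K$ non-zero coordinates, and write $(t)_+=\max(t,0)$. For every $\delta_0>0$ there are constants $C,C'>0$, depending only on $\delta_0$, such that for all $0<\delta\le\delta_0$, all $0<\eta<1$ and all positive integers $M,N$ with $(M,N)\neq(1,1)$ the following hold. (Gaussian random frame coefficient quantization, GRFCQ.) If $M\ge N$, then $$\mathbb P\Big[\mathcal E_\delta(\Phi,\xi,\mathbb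 B^N)\le C\Big(\tfrac NM\log\tfrac{M}{\sqrt N}+\tfrac1M\big(\log\tfrac1{2\eta}\big)_+\Big)\Big]\ge 1-\eta ;$$ in particular, if moreover $\eta\le\tfrac12$, then $$\mathbb P\Big[\mathcal E_\delta(\Phi,\xi,\mathbb B^N)\le C\Big(\tfrac NM\log\tfrac{M}{\sqrt N}+\log\tfrac1{2\eta}\Big)\Big]\ge 1-\eta .$$ (Quantized compressed sensing, QCS.) If $1\le K\le\min(M,N)$, then $$\mathbb P\Big[\mathcal E_\delta(\Phi,\xi,\Sigma_K\cap\mathbb B^N)\le C'\Big(\tfrac KM\log\tfrac{MN}{\sqrt{K^3}}+\tfrac1M\big(\log\tfrac1{2\eta}\big)_+\Big)\Big]\ge 1-\eta ;$$ in particular, if moreover $\eta\le\tfrac12$, then $$\mathbb P\Big[\mathcal E_\delta(\Phi,\xi,\Sigma_K\cap\mathbb B^N)\le C'\Big(\tfrac KM\log\tfrac{MN}{\sqrt{K^3}}+\log\tfrac1{2\eta}\Big)\Big]\ge 1-\eta .$$ -/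

import Mathlib

open MeasureTheory ProbabilityTheory
open scoped Matrix

noncomputable section

/-- The uniform midrise scalar quantizer of resolution `δ`. -/
def midriseQuantizer (δ t : ℝ) : ℝ := δ * ((⌊t / δ⌋ : ℝ) + 1 / 2)

/-- The quantized dithered observation of `x`: the midrise quantizer is applied componentwise to
`Φ x + ξ`. -/
def quantizedSensing {M N : ℕ} (δ : ℝ) (Φ : Matrix (Fin M) (Fin N) ℝ) (ξ : Fin M → ℝ)
    (x : EuclideanSpace ℝ (Fin N)) : Fin M → ℝ :=
  fun i => midriseQuantizer δ ((Φ *ᵥ x.ofLp) i + ξ i)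

/-- The consistency cell of `x` in the signal set `S`: all the signals of `S` with the same
quantized observation as `x`. -/
def consistencyCell {M N : ℕ} (δ : ℝ) (Φ : Matrix (Fin M) (Fin N) ℝ) (ξ : Fin M → ℝ)
    (S : Set (EuclideanSpace ℝ (Fin N))) (x : EuclideanSpace ℝ (Fin N)) :
    Set (EuclideanSpace ℝ (Fin N)) :=
  {y | y ∈ S ∧ quantizedSensing δ Φ ξ y = quantizedSensing δ Φ ξ x}

/-- The worst-case Euclidean error of consistent reconstruction over the signal set `S`. It is used
for non-empty bounded `S`, where the supremum is taken over a non-empty bounded set of reals. -/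
def worstCaseError {M N : ℕ} (δ : ℝ) (Φ : Matrix (Fin M) (Fin N) ℝ) (ξ : Fin M → ℝ)
    (S : Set (EuclideanSpace ℝ (Fin N))) : ℝ :=
  sSup {d | ∃ x ∈ S, ∃ y ∈ consistencyCell δ Φ ξ S x, d = ‖x - y‖}

/-- The closed Euclidean unit ball of `ℝ^N`. -/
def unitBall (N : ℕ) : Set (EuclideanSpace ℝ (Fin N)) := Metric.closedBall 0 1

/-- The `K`-sparse vectors of `ℝ^N` in the canonical basis. -/
def sparseVectors (N K : ℕ) : Set (EuclideanSpace ℝ (Fin N)) :=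
  {v | (Finset.univ.filter fun j => v j ≠ 0).card ≤ K}

/-- The law of the array of entries of an `M × N` matrix with independent standard normal entries. -/
def gaussianMatrixLaw (M N : ℕ) : Measure (Fin M → Fin N → ℝ) :=
  Measure.pi fun _ => Measure.pi fun _ => gaussianReal 0 1

/-- The law of a vector of length `M` with independent entries, uniform on `[0, δ]`. -/
def ditherLaw (M : ℕ) (δ : ℝ) : Measure (Fin M → ℝ) :=
  Measure.pi fun _ => ProbabilityTheory.cond volume (Set.Icc 0 δ)

/-- The joint law of a Gaussian matrix `Φ` and an independent uniform dithering `ξ`. -/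
def sensingLaw (M N : ℕ) (δ : ℝ) : Measure ((Fin M → Fin N → ℝ) × (Fin M → ℝ)) :=
  (gaussianMatrixLaw M N).prod (ditherLaw M δ)

/-- The event `A` holds with probability at least `p`. The lower bound is required of a measurable
event contained in `A` (so no measurability of `A` itself has to be presupposed, and the bound is
not merely one on the outer measure of `A`). -/
def HoldsWithProbAtLeast {Ω : Type*} [MeasurableSpace Ω] (μ : Measure Ω) (p : ℝ) (A : Set Ω) :
    Prop :=
  ∃ B : Set Ω, MeasurableSet B ∧ B ⊆ A ∧ ENNReal.ofReal p ≤ μ B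

end

/-!
Both parts come from one estimate for `K`-sparse vectors: for `K = N` every vector is sparse and
`M N / √(N ^ 3) = M / √N`.

Suppose consistent `x`, `y` of the signal set satisfy `‖x - y‖ > s`. Approximate them by points
`p`, `q` of a finite grid of sparse vectors whose spacing is `1 / (M K)`. Row by row, the dithered
projections of `x` and `y` lie in short intervals around those of `p` and `q`, and no quantization
threshold separates the two intervals (`mem_confusionEvent`). A uniform dither puts a threshold into
an interval of length `d` with probability `min 1 (d / δ)` (`dither_floor_le`), and
`⟨φ, p - q⟩` is a centred Gaussian of standard deviation `‖p - q‖`. Averaging over `φ`, one row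
confuses `p` and `q` with probability at most `1 - c s / 4`, where
`c = 𝔼 min (1, |g| / δ₀)` for a standard normal `g`; the lengths of the short intervals enter only
through their mean, of order `1 / M` (`measure_confusionEvent_le`). The rows are independent, so a
pair is confused with probability at most `exp (-c M s / 4)` (`sensingLaw_forall_mem`).

The grid has at most `(M N) ^ (4 K)` points, and `K ^ 2 ≤ M N` makes `log (M N)` at most four times
`log (M N / K ^ (3 / 2))` (`log_mul_le_four_mul_log`). Hence the union bound over the pairs of grid
points succeeds as soon as `s` is a large multiple of
`(K log (M N / K ^ (3 / 2)) + (log (1 / (2 η)))₊) / M`; such an `s` is also at least a large multiple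
of `1 / M`, so the approximation errors are negligible.
-/

/-! ### Gaussian projections -/

/-- Rotation invariance: the projection of a standard Gaussian vector along `v` is distributed as
`‖v‖` times a standard normal variable. -/
lemma map_dotProduct_gaussian {N : ℕ} (v : EuclideanSpace ℝ (Fin N)) :
    (Measure.pi fun _ : Fin N => gaussianReal 0 1).map (fun φ => φ ⬝ᵥ v.ofLp) =
      (gaussianReal 0 1).map (fun g => ‖v‖ * g) := by
  have h1 : (fun φ : Fin N → ℝ => φ ⬝ᵥ v.ofLp) = innerSL ℝ v ∘ WithLp.toLp 2 := by
    ext φ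
    simp [PiLp.inner_apply, dotProduct]
  rw [h1, ← Measure.map_map (by fun_prop) (by fun_prop), map_pi_eq_stdGaussian,
    IsGaussian.map_eq_gaussianReal, integral_strongDual_stdGaussian, variance_dual_stdGaussian,
    gaussianReal_map_const_mul, innerSL_apply_norm]
  congr 1
  · simp
  · ext; simp

lemma integrable_abs_gaussian : Integrable (fun g : ℝ => |g|) (gaussianReal 0 1) :=
  ((memLp_id_gaussianReal 1).integrable (by simp)).abs

lemma integral_min_one_abs_pos {δ₀ : ℝ} (hδ₀ : 0 < δ₀) :
    0 < ∫ g, min 1 (|g| / δ₀) ∂(gaussianReal 0 1) := by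
  have hint : Integrable (fun g : ℝ => min 1 (|g| / δ₀)) (gaussianReal 0 1) :=
    (integrable_const 1).inf (integrable_abs_gaussian.div_const _)
  rw [integral_pos_iff_support_of_nonneg (fun g => by positivity) hint]
  have hsup : Function.support (fun g : ℝ => min 1 (|g| / δ₀)) = {0}ᶜ := by
    ext g
    by_cases hg : g = 0
    · simp [hg]
    · have : 0 < min 1 (|g| / δ₀) := by positivity
      simp [hg, this.ne']
  have := nullSingletonClass_gaussianReal (μ := 0) (v := 1) one_ne_zero
  rw [hsup, prob_compl_eq_one_sub (measurableSet_singleton _)]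
  simp

/-- For `t ≤ 1`, concavity gives `min 1 (t u) ≥ t min 1 u`, so the mean truncated projection grows
at least linearly in the length of `v`. -/
lemma mul_le_integral_min_one_dotProduct {N : ℕ} {δ₀ t : ℝ} (hδ₀ : 0 < δ₀)
    (ht1 : t ≤ 1) (v : EuclideanSpace ℝ (Fin N)) (hv : t ≤ ‖v‖) :
    t * ∫ g, min 1 (|g| / δ₀) ∂(gaussianReal 0 1) ≤
      ∫ φ, min 1 (|φ ⬝ᵥ v.ofLp| / δ₀) ∂(Measure.pi fun _ : Fin N => gaussianReal 0 1) := by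
  have h1 : ∫ φ, min 1 (|φ ⬝ᵥ v.ofLp| / δ₀) ∂(Measure.pi fun _ : Fin N => gaussianReal 0 1) =
      ∫ g, min 1 (|‖v‖ * g| / δ₀) ∂(gaussianReal 0 1) := by
    rw [← integral_map (φ := fun g => ‖v‖ * g) (f := fun u : ℝ => min 1 (|u| / δ₀)) (by fun_prop)
      (by fun_prop), ← map_dotProduct_gaussian v, integral_map]
    · exact Measurable.aemeasurable (by unfold dotProduct; fun_prop)
    · fun_prop
  rw [h1, ← integral_const_mul]
  refine integral_mono (((integrable_const 1).inf (integrable_abs_gaussian.div_const _)).const_mul _)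
    ((integrable_const 1).inf ?_) fun g => ?_
  · simp_rw [abs_mul]
    exact (integrable_abs_gaussian.const_mul _).div_const _
  · simp only [abs_mul, abs_norm]
    refine le_min ?_ ?_
    · calc t * min 1 (|g| / δ₀) ≤ 1 * 1 := by gcongr; exact min_le_left _ _
        _ = 1 := one_mul 1
    · rw [mul_div_assoc]
      gcongr
      exact min_le_right _ _

/-! ### A uniform dither separates two intervals -/

/-- A uniform dither on `[0, δ]` fails to put a threshold of `δ ℤ` between `a` and `b` with
probability at most `(1 - (b - a)₊ / δ)₊`. The weaker bound with `δ₀` in place of `δ` loses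
constants only and does not degenerate as `δ → 0`. -/
lemma dither_floor_le {δ δ₀ a b : ℝ} (hδ : 0 < δ) (hδ₀ : δ ≤ δ₀) :
    cond volume (Set.Icc 0 δ) {t : ℝ | ⌊(b + t) / δ⌋ ≤ ⌊(a + t) / δ⌋} ≤
      ENNReal.ofReal (1 - min 1 ((b - a) / δ₀)) := by
  have hprob : IsProbabilityMeasure (cond volume (Set.Icc 0 δ)) :=
    cond_isProbabilityMeasure_of_finite (by simp [hδ]) (by simp)
  have hδ₀' : 0 < δ₀ := hδ.trans_le hδ₀
  rcases le_or_gt b a with hab | hab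
  · refine prob_le_one.trans ?_
    rw [← ENNReal.ofReal_one]
    apply ENNReal.ofReal_le_ofReal
    have : (b - a) / δ₀ ≤ 0 := div_nonpos_of_nonpos_of_nonneg (by linarith) hδ₀'.le
    linarith [min_le_right 1 ((b - a) / δ₀)]
  -- `m δ` is the first quantization threshold above `b`
  set m : ℤ := ⌊b / δ⌋ + 1 with hm
  have hm1 : b < m * δ := by
    have := Int.lt_floor_add_one (b / δ)
    rw [div_lt_iff₀ hδ] at this
    simpa [hm] using this
  have hm2 : (m - 1) * δ ≤ b := by
    have := Int.floor_le (b / δ)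
    rw [le_div_iff₀ hδ] at this
    simpa [hm] using this
  -- a threshold crossed by the dithered interval makes the two floors differ
  have key : ∀ (k : ℤ) (t : ℝ), k * δ ≤ b + t → a + t < k * δ →
      ¬ ⌊(b + t) / δ⌋ ≤ ⌊(a + t) / δ⌋ := by
    intro k t h1 h2 h3
    have h4 : k ≤ ⌊(b + t) / δ⌋ := Int.le_floor.2 ((le_div_iff₀ hδ).2 h1)
    have h5 : ⌊(a + t) / δ⌋ < k := Int.floor_lt.2 ((div_lt_iff₀ hδ).2 h2)
    omega
  have hvol : volume (Set.Icc 0 δ ∩ {t : ℝ | ⌊(b + t) / δ⌋ ≤ ⌊(a + t) / δ⌋}) ≤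
      ENNReal.ofReal (δ - (b - a)) := by
    rcases le_or_gt (m * δ - a) δ with hc | hc
    · have hsub : Set.Icc 0 δ ∩ {t : ℝ | ⌊(b + t) / δ⌋ ≤ ⌊(a + t) / δ⌋} ⊆
          Set.Icc 0 (m * δ - b) ∪ Set.Icc (m * δ - a) δ := by
        rintro t ⟨⟨h0, h1⟩, ht⟩
        by_contra hcon
        simp only [Set.mem_union, Set.mem_Icc, not_or, not_and, not_le] at hcon
        refine key m t ?_ ?_ ht
        · linarith [hcon.1 h0]
        · by_contra h
          linarith [hcon.2 (by linarith)]
      refine (measure_mono hsub).trans ((measure_union_le _ _).trans ?_)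
      rw [Real.volume_Icc, Real.volume_Icc, ← ENNReal.ofReal_add (by linarith) (by linarith)]
      exact ENNReal.ofReal_le_ofReal (by linarith)
    · have hsub : Set.Icc 0 δ ∩ {t : ℝ | ⌊(b + t) / δ⌋ ≤ ⌊(a + t) / δ⌋} ⊆
          Set.Icc ((m - 1) * δ - a) (m * δ - b) := by
        rintro t ⟨⟨h0, h1⟩, ht⟩
        refine ⟨?_, ?_⟩
        · by_contra h
          refine key (m - 1) t ?_ ?_ ht <;> push_cast <;> linarith
        · by_contra h
          exact key m t (by linarith) (by linarith) ht
      refine (measure_mono hsub).trans ?_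
      rw [Real.volume_Icc]
      exact ENNReal.ofReal_le_ofReal (by linarith)
  rw [cond_apply measurableSet_Icc, Real.volume_Icc, sub_zero, ← ENNReal.ofReal_inv_of_pos hδ]
  refine (mul_le_mul_right hvol _).trans ?_
  rw [← ENNReal.ofReal_mul (by positivity)]
  have h6 : δ⁻¹ * (δ - (b - a)) = 1 - (b - a) / δ := by field_simp
  rw [h6]
  have h7 : (b - a) / δ₀ ≤ (b - a) / δ := div_le_div_of_nonneg_left (by linarith) hδ hδ₀
  exact ENNReal.ofReal_le_ofReal (by linarith [min_le_right 1 ((b - a) / δ₀)])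

/-! ### Confusion events of two neighbourhoods -/

/-- The event, for one measurement vector `φ` and one dither value `t`, that no quantization
threshold separates the `e φ`-neighbourhoods of `⟨φ, p⟩ + t` and `⟨φ, q⟩ + t`. -/
def confusionEvent {N : ℕ} (δ : ℝ) (p q : EuclideanSpace ℝ (Fin N)) (e : (Fin N → ℝ) → ℝ) :
    Set ((Fin N → ℝ) × ℝ) :=
  {w | ⌊(max (w.1 ⬝ᵥ p.ofLp) (w.1 ⬝ᵥ q.ofLp) - e w.1 + w.2) / δ⌋ ≤
    ⌊(min (w.1 ⬝ᵥ p.ofLp) (w.1 ⬝ᵥ q.ofLp) + e w.1 + w.2) / δ⌋}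

lemma measurableSet_confusionEvent {N : ℕ} (δ : ℝ) (p q : EuclideanSpace ℝ (Fin N))
    {e : (Fin N → ℝ) → ℝ} (he : Measurable e) : MeasurableSet (confusionEvent δ p q e) := by
  unfold confusionEvent dotProduct
  refine measurableSet_le (Int.measurable_floor.comp ?_) (Int.measurable_floor.comp ?_) <;> fun_prop

/-- Two signals whose projections are `e φ`-close to those of `p` and `q` can share their quantized
value only on the confusion event. -/
lemma mem_confusionEvent {N : ℕ} {δ : ℝ} (hδ : 0 < δ) {p q x y : EuclideanSpace ℝ (Fin N)}
    {e : (Fin N → ℝ) → ℝ} {φ : Fin N → ℝ} {t : ℝ}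
    (hx : |φ ⬝ᵥ x.ofLp - φ ⬝ᵥ p.ofLp| ≤ e φ) (hy : |φ ⬝ᵥ y.ofLp - φ ⬝ᵥ q.ofLp| ≤ e φ)
    (h : midriseQuantizer δ (φ ⬝ᵥ x.ofLp + t) = midriseQuantizer δ (φ ⬝ᵥ y.ofLp + t)) :
    (φ, t) ∈ confusionEvent δ p q e := by
  have hfl : ⌊(φ ⬝ᵥ x.ofLp + t) / δ⌋ = ⌊(φ ⬝ᵥ y.ofLp + t) / δ⌋ := by
    unfold midriseQuantizer at h
    have := mul_left_cancel₀ hδ.ne' h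
    exact_mod_cast add_right_cancel this
  rw [abs_le] at hx hy
  have mono : ∀ u v : ℝ, u ≤ v → ⌊u / δ⌋ ≤ ⌊v / δ⌋ := fun u v huv =>
    Int.floor_le_floor (div_le_div_of_nonneg_right huv hδ.le)
  simp only [confusionEvent, Set.mem_ofPred_eq]
  rcases le_total (φ ⬝ᵥ p.ofLp) (φ ⬝ᵥ q.ofLp) with hpq | hpq
  · rw [max_eq_right hpq, min_eq_left hpq]
    exact (mono _ (φ ⬝ᵥ y.ofLp + t) (by linarith)).trans
      (hfl.symm.le.trans (mono _ _ (by linarith)))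
  · rw [max_eq_left hpq, min_eq_right hpq]
    exact (mono _ (φ ⬝ᵥ x.ofLp + t) (by linarith)).trans
      (hfl.le.trans (mono _ _ (by linarith)))

/-- The radius `e` is random, but only its mean is paid for: `u ↦ min 1 (u / δ₀)` is
`1 / δ₀`-Lipschitz, and no concentration of `e` is needed. -/
lemma measure_confusionEvent_le {N : ℕ} {δ δ₀ s : ℝ} (hδ : 0 < δ) (hδ₀ : δ ≤ δ₀)
    {p q : EuclideanSpace ℝ (Fin N)} (hs : s ≤ 1) (hpq : s ≤ ‖p - q‖)
    {e : (Fin N → ℝ) → ℝ} (he : Measurable e) (he0 : ∀ φ, 0 ≤ e φ)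
    (hei : Integrable e (Measure.pi fun _ : Fin N => gaussianReal 0 1)) :
    ((Measure.pi fun _ : Fin N => gaussianReal 0 1).prod (cond volume (Set.Icc 0 δ)))
        (confusionEvent δ p q e) ≤
      ENNReal.ofReal (1 - s * ∫ g, min 1 (|g| / δ₀) ∂(gaussianReal 0 1)
        + 2 / δ₀ * ∫ φ, e φ ∂(Measure.pi fun _ : Fin N => gaussianReal 0 1)) := by
  have hδ₀' : 0 < δ₀ := hδ.trans_le hδ₀
  have hprob : IsProbabilityMeasure (cond volume (Set.Icc 0 δ)) :=
    cond_isProbabilityMeasure_of_finite (by simp [hδ]) (by simp)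
  rw [Measure.prod_apply (measurableSet_confusionEvent δ p q he)]
  set γ := Measure.pi fun _ : Fin N => gaussianReal 0 1 with hγ
  have hmint : Integrable (fun φ => min 1 (|φ ⬝ᵥ (p - q).ofLp| / δ₀)) γ := by
    refine Integrable.of_bound (C := 1) ?_ ?_
    · exact Measurable.aestronglyMeasurable (by unfold dotProduct; fun_prop)
    · refine Filter.Eventually.of_forall fun φ => ?_
      rw [Real.norm_of_nonneg (by positivity)]
      exact min_le_left _ _
  have hpt : ∀ φ, cond volume (Set.Icc 0 δ) (Prod.mk φ ⁻¹' confusionEvent δ p q e) ≤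
      ENNReal.ofReal (1 - min 1 (|φ ⬝ᵥ (p - q).ofLp| / δ₀) + 2 / δ₀ * e φ) := by
    intro φ
    refine (dither_floor_le (a := min (φ ⬝ᵥ p.ofLp) (φ ⬝ᵥ q.ofLp) + e φ)
      (b := max (φ ⬝ᵥ p.ofLp) (φ ⬝ᵥ q.ofLp) - e φ) hδ hδ₀).trans (ENNReal.ofReal_le_ofReal ?_)
    have hd : max (φ ⬝ᵥ p.ofLp) (φ ⬝ᵥ q.ofLp) - min (φ ⬝ᵥ p.ofLp) (φ ⬝ᵥ q.ofLp) =
        |φ ⬝ᵥ (p - q).ofLp| := by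
      rw [max_sub_min_eq_abs', WithLp.ofLp_sub, dotProduct_sub]
    have he' : (max (φ ⬝ᵥ p.ofLp) (φ ⬝ᵥ q.ofLp) - e φ -
        (min (φ ⬝ᵥ p.ofLp) (φ ⬝ᵥ q.ofLp) + e φ)) / δ₀ =
        |φ ⬝ᵥ (p - q).ofLp| / δ₀ - 2 / δ₀ * e φ := by
      rw [← hd]; ring
    rw [he']
    have h0 : 0 ≤ 2 / δ₀ * e φ := mul_nonneg (by positivity) (he0 φ)
    have : min 1 (|φ ⬝ᵥ (p - q).ofLp| / δ₀) - 2 / δ₀ * e φ ≤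
        min 1 (|φ ⬝ᵥ (p - q).ofLp| / δ₀ - 2 / δ₀ * e φ) :=
      le_min (by linarith [min_le_left 1 (|φ ⬝ᵥ (p - q).ofLp| / δ₀)])
        (by linarith [min_le_right 1 (|φ ⬝ᵥ (p - q).ofLp| / δ₀)])
    linarith
  refine (lintegral_mono hpt).trans ?_
  have hint1 : Integrable (fun φ => 1 - min 1 (|φ ⬝ᵥ (p - q).ofLp| / δ₀)) γ :=
    (integrable_const 1).sub hmint
  have hint2 : Integrable
      (fun φ => 1 - min 1 (|φ ⬝ᵥ (p - q).ofLp| / δ₀) + 2 / δ₀ * e φ) γ :=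
    hint1.add (hei.const_mul _)
  rw [← ofReal_integral_eq_lintegral_ofReal hint2]
  · apply ENNReal.ofReal_le_ofReal
    rw [integral_add hint1 (hei.const_mul _), integral_sub (integrable_const 1) hmint,
      integral_const_mul]
    have := mul_le_integral_min_one_dotProduct hδ₀' hs (p - q) hpq
    simp only [integral_const, probReal_univ, smul_eq_mul, mul_one]
    linarith
  · refine Filter.Eventually.of_forall fun φ => ?_
    have h0 : 0 ≤ 2 / δ₀ * e φ := mul_nonneg (by positivity) (he0 φ)
    have := min_le_left 1 (|φ ⬝ᵥ (p - q).ofLp| / δ₀)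
    simp only [Pi.zero_apply]
    linarith

/-- The `M` measurements are independent and identically distributed. -/
lemma sensingLaw_forall_mem {M N : ℕ} {δ : ℝ} (hδ : 0 < δ) {R : Set ((Fin N → ℝ) × ℝ)}
    (hR : MeasurableSet R) :
    MeasurableSet {ω : (Fin M → Fin N → ℝ) × (Fin M → ℝ) | ∀ i, (ω.1 i, ω.2 i) ∈ R} ∧
    sensingLaw M N δ {ω | ∀ i, (ω.1 i, ω.2 i) ∈ R} =
      ((Measure.pi fun _ : Fin N => gaussianReal 0 1).prod (cond volume (Set.Icc 0 δ))) R ^ M := by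
  have hprob : IsProbabilityMeasure (cond volume (Set.Icc 0 δ)) :=
    cond_isProbabilityMeasure_of_finite (by simp [hδ]) (by simp)
  have hmeas : MeasurableSet
      {ω : (Fin M → Fin N → ℝ) × (Fin M → ℝ) | ∀ i, (ω.1 i, ω.2 i) ∈ R} := by
    rw [Set.ofPred_forall]
    exact MeasurableSet.iInter fun i => hR.preimage (by fun_prop)
  refine ⟨hmeas, ?_⟩
  have hmp := measurePreserving_arrowProdEquivProdArrow (Fin N → ℝ) ℝ (Fin M)
    (fun _ => Measure.pi fun _ : Fin N => gaussianReal 0 1) (fun _ => cond volume (Set.Icc 0 δ))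
  rw [sensingLaw, gaussianMatrixLaw, ditherLaw, ← hmp.measure_preimage hmeas.nullMeasurableSet]
  have : (MeasurableEquiv.arrowProdEquivProdArrow (Fin N → ℝ) ℝ (Fin M)) ⁻¹'
      {ω | ∀ i, (ω.1 i, ω.2 i) ∈ R} = Set.univ.pi fun _ => R := by
    ext f
    simp [MeasurableEquiv.arrowProdEquivProdArrow, Equiv.arrowProdEquivProdArrow]
  rw [this, Measure.pi_pi]
  simp

/-! ### A grid of sparse vectors -/

/-- The grid point with code `z`: the combination of the (not necessarily distinct) canonical basis
vectors `(z k).1`, with coefficients in `{-1, -1 + 1 / n, …, 1}`. -/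
noncomputable def gridPoint {N K : ℕ} (n : ℕ) (z : Fin K → Fin N × Fin (2 * n + 1)) :
    EuclideanSpace ℝ (Fin N) :=
  ∑ k, ((((z k).2 : ℕ) : ℝ) / n - 1) • EuclideanSpace.single (z k).1 1

/-- The error of the projection along `φ` made by replacing a sparse vector by its grid point. -/
noncomputable def gridDeviation {N K : ℕ} (n : ℕ) (z : Fin K → Fin N × Fin (2 * n + 1))
    (φ : Fin N → ℝ) : ℝ :=
  ∑ k, |φ (z k).1| / n

lemma exists_grid_coeff {n : ℕ} (hn : 0 < n) {c : ℝ} (hc : |c| ≤ 1) :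
    ∃ j : Fin (2 * n + 1), |c - ((j : ℕ) / n - 1)| ≤ 1 / (n : ℝ) := by
  have hn' : (0 : ℝ) < n := by exact_mod_cast hn
  rw [abs_le] at hc
  have h0 : 0 ≤ (c + 1) * n := mul_nonneg (by linarith) hn'.le
  have h1 := Nat.floor_le h0
  have h2 := Nat.lt_floor_add_one ((c + 1) * n)
  have hle : ⌊(c + 1) * n⌋₊ ≤ 2 * n := by
    have : (c + 1) * n ≤ 2 * n := by gcongr; linarith
    exact_mod_cast h1.trans this
  refine ⟨⟨⌊(c + 1) * n⌋₊, by omega⟩, ?_⟩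
  have h3 : c - ((⌊(c + 1) * n⌋₊ : ℝ) / n - 1) = ((c + 1) * n - ⌊(c + 1) * n⌋₊) / n := by
    field_simp
    ring
  simp only
  rw [h3, abs_of_nonneg (by apply div_nonneg <;> linarith)]
  gcongr
  linarith

lemma exists_sum_single_of_sparse {N K : ℕ} (hKN : K ≤ N) {x : EuclideanSpace ℝ (Fin N)}
    (hx : x ∈ sparseVectors N K) :
    ∃ f : Fin K → Fin N, x = ∑ k, x (f k) • EuclideanSpace.single (f k) 1 := by
  obtain ⟨S, hS, hcard⟩ := Finset.exists_superset_card_eq hx (by simpa using hKN)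
  refine ⟨S.orderEmbOfFin hcard, ?_⟩
  have h1 : ∑ k, x (S.orderEmbOfFin hcard k) •
        (EuclideanSpace.single (S.orderEmbOfFin hcard k) 1 : EuclideanSpace ℝ (Fin N)) =
      ∑ j ∈ S, x j • EuclideanSpace.single j 1 := by
    have := Finset.sum_map Finset.univ (S.orderEmbOfFin hcard).toEmbedding
      fun j => x j • (EuclideanSpace.single j 1 : EuclideanSpace ℝ (Fin N))
    rw [Finset.map_orderEmbOfFin_univ] at this
    exact this.symm
  rw [h1]
  ext i
  by_cases hi : i ∈ S
  · simp [Pi.single_apply, hi]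
  · have : x i = 0 := by
      by_contra h
      exact hi (hS (by simp [h]))
    simp [Pi.single_apply, this]

lemma exists_gridPoint_near {N K n : ℕ} (hKN : K ≤ N) (hn : 0 < n) {x : EuclideanSpace ℝ (Fin N)}
    (hx : x ∈ sparseVectors N K ∩ unitBall N) :
    ∃ z : Fin K → Fin N × Fin (2 * n + 1), ‖x - gridPoint n z‖ ≤ (K : ℝ) / n ∧
      ∀ φ : Fin N → ℝ, |φ ⬝ᵥ x.ofLp - φ ⬝ᵥ (gridPoint n z).ofLp| ≤ gridDeviation n z φ := by
  obtain ⟨f, hf⟩ := exists_sum_single_of_sparse hKN hx.1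
  have hx1 : ‖x‖ ≤ 1 := by simpa [unitBall] using hx.2
  have hc : ∀ k, |x (f k)| ≤ 1 := fun k => (PiLp.norm_apply_le x (f k)).trans hx1
  choose j hj using fun k => exists_grid_coeff hn (hc k)
  have hdiff : x - gridPoint n (fun k => (f k, j k)) =
      ∑ k, (x (f k) - ((j k : ℕ) / n - 1)) • EuclideanSpace.single (f k) (1 : ℝ) := by
    simp only [sub_smul (x _), Finset.sum_sub_distrib, ← hf]
    rfl
  refine ⟨fun k => (f k, j k), ?_, fun φ => ?_⟩
  · rw [hdiff]
    refine (norm_sum_le _ _).trans ?_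
    calc ∑ k, ‖(x (f k) - ((j k : ℕ) / n - 1)) • EuclideanSpace.single (f k) (1 : ℝ)‖
        ≤ ∑ _k : Fin K, 1 / (n : ℝ) := by
          gcongr with k
          rw [norm_smul, PiLp.norm_single, norm_one, mul_one]
          exact hj k
      _ = K / n := by simp [div_eq_mul_inv]
  · rw [← dotProduct_sub, ← WithLp.ofLp_sub, hdiff, WithLp.ofLp_sum, dotProduct_sum]
    refine (Finset.abs_sum_le_sum_abs _ _).trans ?_
    unfold gridDeviation
    gcongr with k
    simp only [WithLp.ofLp_smul, dotProduct_smul, PiLp.ofLp_single, dotProduct_single,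
      smul_eq_mul, mul_one, abs_mul]
    calc |x (f k) - ((j k : ℕ) / n - 1)| * |φ (f k)| ≤ 1 / n * |φ (f k)| := by gcongr; exact hj k
      _ = |φ (f k)| / n := by ring

lemma gridDeviation_nonneg {N K n : ℕ} (z : Fin K → Fin N × Fin (2 * n + 1)) (φ : Fin N → ℝ) :
    0 ≤ gridDeviation n z φ :=
  Finset.sum_nonneg fun _ _ => by positivity

lemma measurable_gridDeviation {N K n : ℕ} (z : Fin K → Fin N × Fin (2 * n + 1)) :
    Measurable (gridDeviation n z) := by
  unfold gridDeviation
  fun_prop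

lemma integrable_gridDeviation {N K n : ℕ} (z : Fin K → Fin N × Fin (2 * n + 1)) :
    Integrable (gridDeviation n z) (Measure.pi fun _ : Fin N => gaussianReal 0 1) := by
  unfold gridDeviation
  refine integrable_finsetSum _ fun k _ => Integrable.div_const ?_ _
  exact (integrable_eval (μ := fun _ : Fin N => gaussianReal 0 1) (i := (z k).1)
    ((memLp_id_gaussianReal 1).integrable (by simp) : Integrable id (gaussianReal 0 1))).abs

lemma integral_gridDeviation {N K n : ℕ} (z : Fin K → Fin N × Fin (2 * n + 1)) :
    ∫ φ, gridDeviation n z φ ∂(Measure.pi fun _ : Fin N => gaussianReal 0 1) =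
      K / n * ∫ g, |g| ∂(gaussianReal 0 1) := by
  unfold gridDeviation
  rw [integral_finsetSum]
  · have h : ∀ k, ∫ φ : Fin N → ℝ, |φ (z k).1| / n ∂(Measure.pi fun _ => gaussianReal 0 1) =
        (∫ g, |g| ∂(gaussianReal 0 1)) / n := by
      intro k
      rw [integral_div, integral_comp_eval (μ := fun _ : Fin N => gaussianReal 0 1) (i := (z k).1)
        (f := fun g : ℝ => |g|) (by fun_prop)]
    simp only [h, Finset.sum_const, Finset.card_univ, Fintype.card_fin, nsmul_eq_mul]
    ring
  · refine fun k _ => Integrable.div_const ?_ _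
    exact (integrable_eval (μ := fun _ : Fin N => gaussianReal 0 1) (i := (z k).1)
      ((memLp_id_gaussianReal 1).integrable (by simp) : Integrable id (gaussianReal 0 1))).abs

/-! ### From the grid to the worst-case error -/

lemma worstCaseError_sparse_le_two {M N K : ℕ} (δ : ℝ) (Φ : Matrix (Fin M) (Fin N) ℝ)
    (ξ : Fin M → ℝ) : worstCaseError δ Φ ξ (sparseVectors N K ∩ unitBall N) ≤ 2 := by
  refine Real.sSup_le ?_ (by norm_num)
  rintro d ⟨x, hx, y, hy, rfl⟩
  have hx1 : ‖x‖ ≤ 1 := by simpa [unitBall] using hx.2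
  have hy1 : ‖y‖ ≤ 1 := by simpa [unitBall] using hy.1.2
  linarith [norm_sub_le x y]

lemma worstCaseError_le_of_grid {M N K n : ℕ} {δ s t : ℝ} (hδ : 0 < δ) (hKN : K ≤ N) (hn : 0 < n)
    (hs : 0 ≤ s) (hts : t ≤ s - 2 * (K / n)) (Φ : Fin M → Fin N → ℝ) (ξ : Fin M → ℝ)
    (h : ∀ z z' : Fin K → Fin N × Fin (2 * n + 1), t ≤ ‖gridPoint n z - gridPoint n z'‖ →
      ¬ ∀ i, (Φ i, ξ i) ∈ confusionEvent δ (gridPoint n z) (gridPoint n z')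
        (fun φ => gridDeviation n z φ + gridDeviation n z' φ)) :
    worstCaseError δ (Matrix.of Φ) ξ (sparseVectors N K ∩ unitBall N) ≤ s := by
  refine Real.sSup_le ?_ hs
  rintro d ⟨x, hx, y, hy, rfl⟩
  by_contra! hlt
  obtain ⟨z, hz, hzφ⟩ := exists_gridPoint_near hKN hn hx
  obtain ⟨z', hz', hzφ'⟩ := exists_gridPoint_near hKN hn hy.1
  refine h z z' ?_ fun i => ?_
  · have htri : ‖x - y‖ ≤ ‖x - gridPoint n z‖ + ‖gridPoint n z - gridPoint n z'‖ +
        ‖y - gridPoint n z'‖ := by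
      rw [← norm_neg (y - gridPoint n z')]
      refine le_trans (le_of_eq ?_) norm_add₃_le
      congr 1
      abel
    linarith
  · refine mem_confusionEvent hδ (x := x) (y := y)
      ((hzφ (Φ i)).trans (le_add_of_nonneg_right (gridDeviation_nonneg z' _)))
      ((hzφ' (Φ i)).trans (le_add_of_nonneg_left (gridDeviation_nonneg z _))) ?_
    have := congrFun hy.2 i
    exact this.symm

/-- The union bound over the pairs of distant grid points. -/
lemma holdsWithProbAtLeast_worstCaseError_le {M N K n : ℕ} {δ δ₀ s t η : ℝ} (hδ : 0 < δ)
    (hδ₀ : δ ≤ δ₀) (hKN : K ≤ N) (hn : 0 < n) (hs : 0 ≤ s) (ht1 : t ≤ 1)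
    (hts : t ≤ s - 2 * (K / n)) (hη : 0 < η)
    (hbound : ((N : ENNReal) * (2 * n + 1)) ^ (2 * K) *
      ENNReal.ofReal (1 - t * ∫ g, min 1 (|g| / δ₀) ∂(gaussianReal 0 1)
        + 2 / δ₀ * (2 * (K / n * ∫ g, |g| ∂(gaussianReal 0 1)))) ^ M ≤ ENNReal.ofReal η) :
    HoldsWithProbAtLeast (sensingLaw M N δ) (1 - η)
      {ω | worstCaseError δ (Matrix.of ω.1) ω.2 (sparseVectors N K ∩ unitBall N) ≤ s} := by
  have hprob : IsProbabilityMeasure (cond volume (Set.Icc 0 δ)) :=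
    cond_isProbabilityMeasure_of_finite (by simp [hδ]) (by simp)
  have hP : IsProbabilityMeasure (sensingLaw M N δ) := by
    unfold sensingLaw gaussianMatrixLaw ditherLaw
    infer_instance
  let Z := (Fin K → Fin N × Fin (2 * n + 1))
  let R : Z × Z → Set ((Fin N → ℝ) × ℝ) := fun w =>
    confusionEvent δ (gridPoint n w.1) (gridPoint n w.2)
      (fun φ => gridDeviation n w.1 φ + gridDeviation n w.2 φ)
  have hRm : ∀ w, MeasurableSet (R w) := fun w => measurableSet_confusionEvent _ _ _
    ((measurable_gridDeviation w.1).add (measurable_gridDeviation w.2))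
  let B : Z × Z → Set ((Fin M → Fin N → ℝ) × (Fin M → ℝ)) := fun w =>
    {ω | t ≤ ‖gridPoint n w.1 - gridPoint n w.2‖ ∧ ∀ i, (ω.1 i, ω.2 i) ∈ R w}
  have hB : ∀ w, MeasurableSet (B w) ∧ sensingLaw M N δ (B w) ≤
      ENNReal.ofReal (1 - t * ∫ g, min 1 (|g| / δ₀) ∂(gaussianReal 0 1)
        + 2 / δ₀ * (2 * (K / n * ∫ g, |g| ∂(gaussianReal 0 1)))) ^ M := by
    intro w
    by_cases hw : t ≤ ‖gridPoint n w.1 - gridPoint n w.2‖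
    · have hBw : B w = {ω | ∀ i, (ω.1 i, ω.2 i) ∈ R w} := by
        ext ω
        simp [B, hw]
      obtain ⟨h1, h2⟩ := sensingLaw_forall_mem (M := M) hδ (hRm w)
      rw [hBw, h2]
      refine ⟨h1, ?_⟩
      gcongr
      refine (measure_confusionEvent_le hδ hδ₀ ht1 hw
        ((measurable_gridDeviation w.1).add (measurable_gridDeviation w.2))
        (fun φ => add_nonneg (gridDeviation_nonneg _ _) (gridDeviation_nonneg _ _))
        ((integrable_gridDeviation w.1).add (integrable_gridDeviation w.2))).trans (le_of_eq ?_)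
      rw [integral_add' (integrable_gridDeviation w.1) (integrable_gridDeviation w.2),
        integral_gridDeviation, integral_gridDeviation, two_mul (_ * _)]
    · have hBw : B w = ∅ := by
        ext ω
        simp [B, hw]
      simp [hBw]
  refine ⟨(⋃ w, B w)ᶜ, (MeasurableSet.iUnion fun w => (hB w).1).compl, ?_, ?_⟩
  · intro ω hω
    refine worstCaseError_le_of_grid hδ hKN hn hs hts ω.1 ω.2 fun z z' hzz hall => hω ?_
    exact Set.mem_iUnion.2 ⟨(z, z'), hzz, hall⟩
  · rw [prob_compl_eq_one_sub (MeasurableSet.iUnion fun w => (hB w).1),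
      ENNReal.ofReal_sub _ hη.le, ENNReal.ofReal_one]
    refine tsub_le_tsub_left ?_ _
    refine (measure_iUnion_fintype_le _ _).trans ((Finset.sum_le_sum fun w _ => (hB w).2).trans ?_)
    refine le_trans (le_of_eq ?_) hbound
    rw [Finset.sum_const, nsmul_eq_mul]
    congr 1
    simp only [Finset.card_univ, Z, Fintype.card_prod, Fintype.card_fun, Fintype.card_fin]
    push_cast
    ring

/-! ### Choice of the resolution -/

/-- Since `K ^ 2 ≤ M N`, the logarithm of `M N / K ^ (3 / 2)` is comparable to that of `M N`: a net
of cardinality polynomial in `M N` is fine enough. -/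
lemma log_mul_le_four_mul_log {M N K : ℕ} (hK : 1 ≤ K) (hKN : K ≤ N) (hKM : K ≤ M) :
    Real.log (M * N) ≤ 4 * Real.log (M * N / Real.sqrt ((K : ℝ) ^ 3)) := by
  have hK0 : (1 : ℝ) ≤ K := by exact_mod_cast hK
  have hKN' : (K : ℝ) ≤ N := by exact_mod_cast hKN
  have hKM' : (K : ℝ) ≤ M := by exact_mod_cast hKM
  have hsq : (K : ℝ) ^ 2 ≤ M * N := by rw [sq]; gcongr
  have hpos : (0 : ℝ) < M * N := by nlinarith
  have h1 : 2 * Real.log K ≤ Real.log (M * N) := by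
    have := Real.log_le_log (by positivity) hsq
    rwa [Real.log_pow, Nat.cast_ofNat] at this
  rw [Real.log_div hpos.ne' (by positivity), Real.log_sqrt (by positivity), Real.log_pow]
  push_cast
  linarith

lemma card_grid_le {M N K : ℕ} (hK : 1 ≤ K) (hKN : K ≤ N) (hKM : K ≤ M) (hMN : 2 ≤ M * N) :
    N * (2 * (M * K) + 1) ≤ (M * N) ^ 4 := by
  have h1 : 1 ≤ M * K := Nat.mul_pos (hK.trans hKM) hK
  have h2 : K ≤ M * N := hKN.trans (Nat.le_mul_of_pos_left N (hK.trans hKM))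
  calc N * (2 * (M * K) + 1) ≤ N * (4 * (M * K)) := Nat.mul_le_mul_left _ (by omega)
    _ = 2 ^ 2 * ((M * N) * K) := by ring
    _ ≤ (M * N) ^ 2 * ((M * N) * (M * N)) := by gcongr
    _ = (M * N) ^ 4 := by ring

/-- The estimate for sparse vectors, with the grid of spacing `1 / (M K)`. In the constant, the
summand `16 / log 2 * _` makes the error level at least a large multiple of `1 / M`, and `144 / c`
pays for the union bound. -/
theorem exists_const_sparse_worstCaseError_le {δ₀ : ℝ} (hδ₀ : 0 < δ₀) :
    ∃ C : ℝ, 0 < C ∧ ∀ (M N K : ℕ) (δ η : ℝ), 1 ≤ K → K ≤ N → K ≤ M → 2 ≤ M * N →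
      0 < δ → δ ≤ δ₀ → 0 < η →
        HoldsWithProbAtLeast (sensingLaw M N δ) (1 - η)
          {ω | worstCaseError δ (Matrix.of ω.1) ω.2 (sparseVectors N K ∩ unitBall N) ≤
            C * ((K : ℝ) / M * Real.log (M * N / Real.sqrt ((K : ℝ) ^ 3))
              + 1 / M * max 0 (Real.log (1 / (2 * η))))} := by
  set c := ∫ g, min 1 (|g| / δ₀) ∂(gaussianReal 0 1) with hc_def
  set m := ∫ g, |g| ∂(gaussianReal 0 1) with hm_def
  have hc : 0 < c := integral_min_one_abs_pos hδ₀
  have hm : 0 ≤ m := integral_nonneg fun g => abs_nonneg g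
  have hlog2 : 0 < Real.log 2 := Real.log_pos (by norm_num)
  refine ⟨16 / Real.log 2 * (1 + 4 * m / (δ₀ * c)) + 144 / c, by positivity, ?_⟩
  set C := 16 / Real.log 2 * (1 + 4 * m / (δ₀ * c)) + 144 / c with hC
  intro M N K δ η hK hKN hKM hMN hδ hδδ₀ hη
  set L := Real.log (M * N / Real.sqrt ((K : ℝ) ^ 3)) with hL
  set T := max 0 (Real.log (1 / (2 * η))) with hT
  have hK1 : (1 : ℝ) ≤ K := by exact_mod_cast hK
  have hM1 : (1 : ℝ) ≤ M := by exact_mod_cast hK.trans hKM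
  have hM0 : (0 : ℝ) < M := by linarith
  have hMN2 : (2 : ℝ) ≤ M * N := by exact_mod_cast hMN
  have hLlog : Real.log (M * N) ≤ 4 * L := log_mul_le_four_mul_log hK hKN hKM
  have hlog : Real.log 2 ≤ Real.log (M * N) := Real.log_le_log (by norm_num) hMN2
  have hL0 : 0 < L := by linarith
  have hT0 : 0 ≤ T := le_max_left _ _
  have hLK : L ≤ K * L := le_mul_of_one_le_left hL0.le hK1
  set s := C * ((K : ℝ) / M * L + 1 / M * T) with hs
  have hsM : M * s = C * (K * L + T) := by
    rw [hs]
    field_simp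
  have hC1 : 16 / Real.log 2 * (1 + 4 * m / (δ₀ * c)) ≤ C :=
    le_add_of_nonneg_right (by positivity)
  have hC2 : 144 / c ≤ C := le_add_of_nonneg_left (by positivity)
  have hC0 : 0 < C := lt_of_lt_of_le (by positivity) hC2
  -- `s` is at least a large multiple of `1 / M`, so the grid spacing is negligible
  have hsM1 : 4 + 16 * m / (δ₀ * c) ≤ M * s := by
    calc 4 + 16 * m / (δ₀ * c)
        = 16 / Real.log 2 * (1 + 4 * m / (δ₀ * c)) * (Real.log 2 / 4) := by
          field_simp
          ring
      _ ≤ C * (K * L + T) := by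
          gcongr
          linarith
      _ = M * s := hsM.symm
  have hs0 : 0 ≤ s := by positivity
  rcases le_or_gt 2 s with h2 | h2
  · have hprob : IsProbabilityMeasure (cond volume (Set.Icc 0 δ)) :=
      cond_isProbabilityMeasure_of_finite (by simp [hδ]) (by simp)
    have hP : IsProbabilityMeasure (sensingLaw M N δ) := by
      unfold sensingLaw gaussianMatrixLaw ditherLaw
      infer_instance
    refine ⟨Set.univ, MeasurableSet.univ,
      fun ω _ => (worstCaseError_sparse_le_two δ (Matrix.of ω.1) ω.2).trans h2, ?_⟩
    rw [measure_univ, ENNReal.ofReal_le_one]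
    linarith
  have hKn : (K : ℝ) / ((M * K : ℕ) : ℝ) = 1 / M := by
    push_cast
    field_simp
  have h4 : 4 / M ≤ s := by
    rw [div_le_iff₀ hM0]
    have : 0 ≤ 16 * m / (δ₀ * c) := by positivity
    linarith
  refine holdsWithProbAtLeast_worstCaseError_le (n := M * K) (t := s / 2) hδ hδδ₀ hKN
    (Nat.mul_pos (hK.trans hKM) hK) hs0 (by linarith) ?_ hη ?_
  · rw [hKn]
    have : 2 * (1 / (M : ℝ)) = 4 / M / 2 := by ring
    linarith
  rw [hKn]
  have hrow : 1 - s / 2 * c + 2 / δ₀ * (2 * (1 / M * m)) ≤ Real.exp (-(c * s / 4)) := by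
    have h5 : 2 / δ₀ * (2 * (1 / M * m)) ≤ c * s / 4 := by
      have h6 : 16 * m / (δ₀ * c) ≤ M * s := by linarith
      rw [div_le_iff₀ (by positivity)] at h6
      have h7 : 2 / δ₀ * (2 * (1 / M * m)) = 4 * m / (δ₀ * M) := by
        field_simp
        ring
      rw [h7, div_le_iff₀ (by positivity)]
      linarith
    have := Real.add_one_le_exp (-(c * s / 4))
    linarith
  have hgrid : (N : ENNReal) * (2 * (M * K : ℕ) + 1) ≤ ENNReal.ofReal (M * N) ^ 4 := by
    have h8 : ENNReal.ofReal ((M : ℝ) * N) = ((M * N : ℕ) : ENNReal) := by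
      rw [← ENNReal.ofReal_natCast]
      push_cast
      rfl
    rw [h8]
    exact_mod_cast card_grid_le hK hKN hKM hMN
  calc _ ≤ (ENNReal.ofReal (M * N) ^ 4) ^ (2 * K) *
        ENNReal.ofReal (Real.exp (-(c * s / 4))) ^ M := by gcongr
    _ = ENNReal.ofReal (Real.exp (8 * K * Real.log (M * N) - c / 4 * (M * s))) := by
        rw [← pow_mul, ← ENNReal.ofReal_pow (by positivity), ← ENNReal.ofReal_pow (by positivity),
          ← ENNReal.ofReal_mul (by positivity), ← Real.exp_nat_mul, sub_eq_add_neg, Real.exp_add]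
        congr 2
        · rw [← Real.exp_log (by linarith : (0 : ℝ) < M * N), ← Real.exp_nat_mul, Real.log_exp]
          push_cast
          ring_nf
        · ring_nf
    _ ≤ ENNReal.ofReal η := by
        apply ENNReal.ofReal_le_ofReal
        rw [← Real.le_log_iff_exp_le hη, hsM]
        have h9 : 36 * (K * L + T) ≤ c / 4 * (C * (K * L + T)) := by
          rw [← mul_assoc]
          gcongr
          rw [div_le_iff₀ hc] at hC2
          linarith
        have h10 : Real.log (1 / (2 * η)) = -Real.log 2 - Real.log η := by
          rw [one_div, Real.log_inv, Real.log_mul (by norm_num) hη.ne']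
          ring
        have h11 : Real.log (1 / (2 * η)) ≤ T := le_max_right _ _
        have h12 : 8 * K * Real.log (M * N) ≤ 8 * K * (4 * L) := by gcongr
        linarith

theorem corollary1 (δ₀ : ℝ) (hδ₀ : 0 < δ₀) :
    (∃ C : ℝ, 0 < C ∧
      ∀ (M N : ℕ) (δ η : ℝ), N ≤ M → 2 ≤ M * N → 0 < δ → δ ≤ δ₀ → 0 < η → η < 1 →
        (η ≤ 1 / 2 →
          HoldsWithProbAtLeast (sensingLaw M N δ) (1 - η)
            {ω | worstCaseError δ (Matrix.of ω.1) ω.2 (unitBall N) ≤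
              C * ((N : ℝ) / M * Real.log (M / Real.sqrt N) + Real.log (1 / (2 * η)))}) ∧
        HoldsWithProbAtLeast (sensingLaw M N δ) (1 - η)
          {ω | worstCaseError δ (Matrix.of ω.1) ω.2 (unitBall N) ≤
            C * ((N : ℝ) / M * Real.log (M / Real.sqrt N)
              + 1 / M * max 0 (Real.log (1 / (2 * η))))}) ∧
    (∃ C' : ℝ, 0 < C' ∧
      ∀ (M N K : ℕ) (δ η : ℝ), 1 ≤ K → K ≤ N → K ≤ M → 2 ≤ M * N →
        0 < δ → δ ≤ δ₀ → 0 < η → η < 1 →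
        (η ≤ 1 / 2 →
          HoldsWithProbAtLeast (sensingLaw M N δ) (1 - η)
            {ω | worstCaseError δ (Matrix.of ω.1) ω.2 (sparseVectors N K ∩ unitBall N) ≤
              C' * ((K : ℝ) / M * Real.log (M * N / Real.sqrt ((K : ℝ) ^ 3))
                + Real.log (1 / (2 * η)))}) ∧
        HoldsWithProbAtLeast (sensingLaw M N δ) (1 - η)
          {ω | worstCaseError δ (Matrix.of ω.1) ω.2 (sparseVectors N K ∩ unitBall N) ≤
            C' * ((K : ℝ) / M * Real.log (M * N / Real.sqrt ((K : ℝ) ^ 3))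
              + 1 / M * max 0 (Real.log (1 / (2 * η))))}) := by
  obtain ⟨C, hC, h⟩ := exists_const_sparse_worstCaseError_le hδ₀
  have hsparse : ∀ (M N K : ℕ) (δ η : ℝ), 1 ≤ K → K ≤ N → K ≤ M → 2 ≤ M * N →
      0 < δ → δ ≤ δ₀ → 0 < η →
        (η ≤ 1 / 2 →
          HoldsWithProbAtLeast (sensingLaw M N δ) (1 - η)
            {ω | worstCaseError δ (Matrix.of ω.1) ω.2 (sparseVectors N K ∩ unitBall N) ≤
              C * ((K : ℝ) / M * Real.log (M * N / Real.sqrt ((K : ℝ) ^ 3))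
                + Real.log (1 / (2 * η)))}) ∧
        HoldsWithProbAtLeast (sensingLaw M N δ) (1 - η)
          {ω | worstCaseError δ (Matrix.of ω.1) ω.2 (sparseVectors N K ∩ unitBall N) ≤
            C * ((K : ℝ) / M * Real.log (M * N / Real.sqrt ((K : ℝ) ^ 3))
              + 1 / M * max 0 (Real.log (1 / (2 * η))))} := by
    intro M N K δ η hK hKN hKM hMN hδ hδδ₀ hη
    have hmain := h M N K δ η hK hKN hKM hMN hδ hδδ₀ hη
    refine ⟨fun hη2 => ?_, hmain⟩
    obtain ⟨B, hB, hBsub, hBμ⟩ := hmain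
    refine ⟨B, hB, fun ω hω => le_trans (b := C * ((K : ℝ) / M *
      Real.log (M * N / Real.sqrt ((K : ℝ) ^ 3)) + 1 / M * max 0 (Real.log (1 / (2 * η)))))
      (hBsub hω) ?_, hBμ⟩
    have hM1 : (1 : ℝ) ≤ M := by exact_mod_cast hK.trans hKM
    have hlog : 0 ≤ Real.log (1 / (2 * η)) :=
      Real.log_nonneg ((one_le_div (by positivity)).2 (by linarith))
    rw [max_eq_right hlog]
    gcongr
    exact mul_le_of_le_one_left hlog ((div_le_one (by linarith)).2 hM1)
  refine ⟨⟨C, hC, fun M N δ η hNM hMN hδ hδδ₀ hη _ => ?_⟩,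
    ⟨C, hC, fun M N K δ η hK hKN hKM hMN hδ hδδ₀ hη _ =>
      hsparse M N K δ η hK hKN hKM hMN hδ hδδ₀ hη⟩⟩
  have hN : 1 ≤ N := Nat.pos_of_ne_zero fun h0 => by simp [h0] at hMN
  have hall : sparseVectors N N ∩ unitBall N = unitBall N := by
    refine Set.inter_eq_right.2 fun x _ => ?_
    change (Finset.univ.filter fun j => x j ≠ 0).card ≤ N
    simpa using Finset.card_le_univ (Finset.univ.filter fun j => x j ≠ 0)
  have hlog : (M : ℝ) * N / Real.sqrt ((N : ℝ) ^ 3) = M / Real.sqrt N := by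
    have hN0 : (0 : ℝ) < N := by exact_mod_cast hN
    rw [pow_succ, Real.sqrt_mul (by positivity), Real.sqrt_sq hN0.le, mul_comm (M : ℝ),
      mul_div_mul_left _ _ hN0.ne']
  have := hsparse M N N δ η hN le_rfl hNM hMN hδ hδδ₀ hη
  rwa [hall, hlog] at this
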